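/- Let $\mathsf G=\operatorname{Spec}A$ be an affine algebraic $\mathbb R$-group, i.e. $A$ is a finitely generated commutative Hopf $\mathbb R$-algebra, and let $\mathsf G(\mathbb R)=\operatorname{Hom}_{\mathbb R\text{-alg}}(A,\mathbb R)$ be its group of rational points, with its canonical structure of real Lie group. Assume that $\mathsf G$ has no imaginary connected components: every connected component of $\operatorname{Spec}A$ contains a rational point. Let $\mathbf{Rep}(\mathsf G)$ be the category of linear representations of $\mathsf G$: finite-dimensional real vector spaces $E$ with a morphism of affine groups $\mathsf G\to \mathsf{Gl}(E)=\operatorname{Spec}\mathbb R[x_{ij}]_{\det}$, i.e. a morphism of Hopf algebras $\mathbb R[x_{ij}]_{\det}\to A$; morphisms are the $\mathsf G$-equivariant linear maps. Let $\mathbf{Rep}_{alg}(\mathsf G(\mathbb R))$ be the category of algebraic linear representations of the Lie group $\mathsf G(\mathbb R)$: finite-dimensional real vector spaces $E$ with a smooth group morphism $\rho\colon\mathsf G(\mathbb R)\to \mathit{Gl}(E)$ each of whose matrix coefficients $g\mapsto \varphi(\rho(g)v)$ ($v\in E$, $\varphi\in E^*$) is the restriction to $\mathsf G(\mathbb R)$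 of an element of $A$; morphisms are the $\mathsf G(\mathbb R)$-equivariant linear maps. Then restriction to rational points is an equivalence of categories $$\mathbf{Rep}(\mathsf G)\;\equiv\;\mathbf{Rep}_{alg}(\mathsf G(\mathbb R)).$$ The corresponding statement for all (smooth, finite-dimensional) linear representations of the Lie group is false: the group $\mathsf{Gl}_1=\operatorname{Spec}\mathbb R[t,t^{-1}]$ has no imaginary connected components, but there is no equivalence of categories between $\mathbf{Rep}(\mathsf{Gl}_1)$ and the category of all linear representations of the Lie group $\mathsf{Gl}_1(\mathbb R)=\mathbb R^\times$. -/

import Mathlib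

open CategoryTheory
open scoped TensorProduct LaurentPolynomial ContDiff

noncomputable section

/-! ### The affine group `GL_n` over `ℝ`

Its coordinate ring is the Hopf algebra `ℝ[x_ij]_det` with `Δ x_ij = ∑ k, x_ik ⊗ x_kj`,
`ε x_ij = δ_ij` and `S x_ij = (x⁻¹)_ij`. -/

/-- The coordinate ring `ℝ[x_ij]_det` of the affine `ℝ`-group `GL_n`. -/
def GLCoord (n : ℕ) : Type :=
  Localization.Away (Matrix.det (Matrix.mvPolynomialX (Fin n) (Fin n) ℝ))

namespace GLCoord

instance (n : ℕ) : CommRing (GLCoord n) :=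
  inferInstanceAs (CommRing (Localization.Away
    (Matrix.det (Matrix.mvPolynomialX (Fin n) (Fin n) ℝ))))

instance (n : ℕ) : Algebra (MvPolynomial (Fin n × Fin n) ℝ) (GLCoord n) :=
  inferInstanceAs (Algebra _ (Localization.Away
    (Matrix.det (Matrix.mvPolynomialX (Fin n) (Fin n) ℝ))))

instance (n : ℕ) : Algebra ℝ (GLCoord n) :=
  inferInstanceAs (Algebra ℝ (Localization.Away
    (Matrix.det (Matrix.mvPolynomialX (Fin n) (Fin n) ℝ))))

instance (n : ℕ) : IsScalarTower ℝ (MvPolynomial (Fin n × Fin n) ℝ) (GLCoord n) :=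
  inferInstanceAs (IsScalarTower ℝ _ (Localization.Away
    (Matrix.det (Matrix.mvPolynomialX (Fin n) (Fin n) ℝ))))

instance (n : ℕ) : IsLocalization.Away
    (Matrix.det (Matrix.mvPolynomialX (Fin n) (Fin n) ℝ)) (GLCoord n) :=
  inferInstanceAs (IsLocalization.Away _ (Localization.Away
    (Matrix.det (Matrix.mvPolynomialX (Fin n) (Fin n) ℝ))))

variable {n : ℕ} {R S : Type*} [CommRing R] [Algebra ℝ R] [CommRing S] [Algebra ℝ S]

/-- The generic invertible matrix `(x_ij)`. -/
def X (n : ℕ) : Matrix (Fin n) (Fin n) (GLCoord n) :=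
  (Matrix.mvPolynomialX (Fin n) (Fin n) ℝ).map (algebraMap _ (GLCoord n))

lemma isUnit_det_X (n : ℕ) : IsUnit (X n).det := by
  have h := IsLocalization.Away.algebraMap_isUnit (S := GLCoord n)
    (Matrix.det (Matrix.mvPolynomialX (Fin n) (Fin n) ℝ))
  rwa [RingHom.map_det] at h

/-- The algebra morphism `ℝ[x_ij]_det → R` sending `(x_ij)` to a given invertible matrix. -/
def lift (M : Matrix (Fin n) (Fin n) R) (hM : IsUnit M.det) : GLCoord n →ₐ[ℝ] R :=
  IsLocalization.Away.liftAlgHom (R := MvPolynomial (Fin n × Fin n) ℝ) (S := GLCoord n)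
    (Matrix.det (Matrix.mvPolynomialX (Fin n) (Fin n) ℝ))
    (f := MvPolynomial.aeval fun p : Fin n × Fin n => M p.1 p.2) (by
      rw [AlgHom.map_det]
      convert hM
      ext i j
      simp [Matrix.mvPolynomialX_apply])

lemma map_X_lift (M : Matrix (Fin n) (Fin n) R) (hM : IsUnit M.det) :
    (X n).map (lift M hM) = M := by
  ext i j
  simp [X, lift, Matrix.mvPolynomialX_apply]

lemma algHom_ext {f g : GLCoord n →ₐ[ℝ] R} (h : (X n).map f = (X n).map g) : f = g := by
  have key : (f : GLCoord n →+* R).comp (algebraMap (MvPolynomial (Fin n × Fin n) ℝ) _) =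
      (g : GLCoord n →+* R).comp (algebraMap _ _) := by
    apply MvPolynomial.ringHom_ext
    · intro r
      have e : algebraMap (MvPolynomial (Fin n × Fin n) ℝ) (GLCoord n) (MvPolynomial.C r) =
          algebraMap ℝ _ r :=
        (IsScalarTower.algebraMap_apply ℝ (MvPolynomial (Fin n × Fin n) ℝ) (GLCoord n) r).symm
      simp [e]
    · intro p
      have := congrFun (congrFun h p.1) p.2
      simpa [X, Matrix.mvPolynomialX_apply] using this
  have := IsLocalization.ringHom_ext
    (Submonoid.powers (Matrix.det (Matrix.mvPolynomialX (Fin n) (Fin n) ℝ))) key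
  exact AlgHom.ext fun x => RingHom.congr_fun this x

lemma isUnit_det_map (f : R →ₐ[ℝ] S) {M : Matrix (Fin n) (Fin n) R} (hM : IsUnit M.det) :
    IsUnit (M.map f).det := by
  have h := hM.map f
  rwa [AlgHom.map_det] at h

open Algebra.TensorProduct in
/-- Comultiplication: `x_ij ↦ ∑ k, x_ik ⊗ x_kj`. -/
def comulHom (n : ℕ) : GLCoord n →ₐ[ℝ] GLCoord n ⊗[ℝ] GLCoord n :=
  lift ((X n).map (includeLeft : GLCoord n →ₐ[ℝ] GLCoord n ⊗[ℝ] GLCoord n) *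
      (X n).map (includeRight : GLCoord n →ₐ[ℝ] GLCoord n ⊗[ℝ] GLCoord n)) (by
    rw [Matrix.det_mul]
    exact (isUnit_det_map _ (isUnit_det_X n)).mul (isUnit_det_map _ (isUnit_det_X n)))

/-- Counit: `x_ij ↦ δ_ij`. -/
def counitHom (n : ℕ) : GLCoord n →ₐ[ℝ] ℝ := lift 1 (by simp)

/-- Antipode: `x_ij ↦ (x⁻¹)_ij`. -/
def antipodeHom (n : ℕ) : GLCoord n →ₐ[ℝ] GLCoord n :=
  lift (X n)⁻¹ (Matrix.isUnit_nonsing_inv_det _ (isUnit_det_X n))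

lemma map_X_comul (n : ℕ) : (X n).map (comulHom n) =
    (X n).map (Algebra.TensorProduct.includeLeft :
      GLCoord n →ₐ[ℝ] GLCoord n ⊗[ℝ] GLCoord n) *
    (X n).map (Algebra.TensorProduct.includeRight :
      GLCoord n →ₐ[ℝ] GLCoord n ⊗[ℝ] GLCoord n) := map_X_lift _ _

lemma comulHom_X (i j : Fin n) :
    comulHom n (X n i j) = ∑ k, X n i k ⊗ₜ[ℝ] X n k j := by
  have := congrFun (congrFun (map_X_comul n) i) j
  simpa [Matrix.mul_apply] using this

lemma counitHom_X (i j : Fin n) :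
    counitHom n (X n i j) = (1 : Matrix (Fin n) (Fin n) ℝ) i j := by
  have := congrFun (congrFun (map_X_lift (1 : Matrix (Fin n) (Fin n) ℝ) (by simp)) i) j
  exact this

lemma antipodeHom_X (i j : Fin n) : antipodeHom n (X n i j) = (X n)⁻¹ i j := by
  have := congrFun (congrFun (map_X_lift (X n)⁻¹
    (Matrix.isUnit_nonsing_inv_det _ (isUnit_det_X n))) i) j
  exact this

instance (n : ℕ) : Bialgebra ℝ (GLCoord n) :=
  Bialgebra.ofAlgHom (comulHom n) (counitHom n)
    (by
      apply algHom_ext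
      ext i j
      simp [comulHom_X, TensorProduct.sum_tmul, TensorProduct.tmul_sum]
      exact Finset.sum_comm)
    (by
      apply algHom_ext
      ext i j
      simp [comulHom_X, counitHom_X, Matrix.one_apply, TensorProduct.ite_tmul])
    (by
      apply algHom_ext
      ext i j
      simp [comulHom_X, counitHom_X, Matrix.one_apply, TensorProduct.tmul_ite])

instance (n : ℕ) : HopfAlgebra ℝ (GLCoord n) :=
  HopfAlgebra.ofAlgHom (antipodeHom n)
    (by
      apply algHom_ext
      ext i j
      have h := congrFun (congrFun (Matrix.nonsing_inv_mul _ (isUnit_det_X n)) i) j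
      change Algebra.TensorProduct.lift _ _ (fun _ _ => Commute.all _ _) (comulHom n (X n i j)) =
        algebraMap ℝ (GLCoord n) (counitHom n (X n i j))
      rw [comulHom_X, counitHom_X]
      simpa [Matrix.mul_apply, antipodeHom_X, Matrix.one_apply, apply_ite] using h)
    (by
      apply algHom_ext
      ext i j
      have h := congrFun (congrFun (Matrix.mul_nonsing_inv _ (isUnit_det_X n)) i) j
      change Algebra.TensorProduct.lift _ _ (fun _ _ => Commute.all _ _) (comulHom n (X n i j)) =
        algebraMap ℝ (GLCoord n) (counitHom n (X n i j))
      rw [comulHom_X, counitHom_X]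
      simpa [Matrix.mul_apply, antipodeHom_X, Matrix.one_apply, apply_ite] using h)

lemma comul_X (i j : Fin n) :
    Coalgebra.comul (R := ℝ) (X n i j) = ∑ k, X n i k ⊗ₜ[ℝ] X n k j := comulHom_X i j

lemma counit_X (i j : Fin n) :
    Coalgebra.counit (R := ℝ) (X n i j) = (1 : Matrix (Fin n) (Fin n) ℝ) i j := counitHom_X i j

end GLCoord

/-! ### Real points -/

section RealPoints

variable (A : Type*) [CommRing A] [HopfAlgebra ℝ A]

/-- The group `G(ℝ)` of rational points of the affine group `G = Spec A`: algebra morphisms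
`A → ℝ`, with the convolution product `(g * h)(a) = ∑ g(a₁) h(a₂)`. -/
abbrev RealPoints : Type _ := WithConv (A →ₐ[ℝ] ℝ)

variable {A}

/-- A rational point as a point of the spectrum. -/
def RealPoints.toSpec (g : RealPoints A) : PrimeSpectrum A :=
  ⟨RingHom.ker g.ofConv, RingHom.ker_isPrime g.ofConv⟩

variable (A) in
/-- `Spec A` has no imaginary connected components: every connected component contains a
rational point. -/
def NoImaginaryComponents : Prop :=
  ∀ p : PrimeSpectrum A, ∃ g : RealPoints A, g.toSpec ∈ connectedComponent p

/-- The coordinates of a rational point with respect to finitely many regular functions. When the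
`a i` generate the algebra `A`, this is a closed embedding of `G(ℝ)` in `ℝⁿ`. -/
def RealPoints.coords {n : ℕ} (a : Fin n → A) (g : RealPoints A) : Fin n → ℝ :=
  fun i => g.ofConv (a i)

/-- Smooth functions on the Lie group `G(ℝ)`. If `A` is generated by `n` elements, `G(ℝ)` is a
closed submanifold of `ℝⁿ`, and its smooth functions are the functions which locally are
restrictions of smooth functions of the ambient space. Since every element of `A` is a polynomial
in the generators, arbitrary finite families of regular functions may be used as coordinates. -/
def RealPoints.IsSmooth (f : RealPoints A → ℝ) : Prop :=
  ∀ g : RealPoints A, ∃ (n : ℕ) (a : Fin n → A) (U : Set (Fin n → ℝ)) (F : (Fin n → ℝ) → ℝ),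
    IsOpen U ∧ RealPoints.coords a g ∈ U ∧ ContDiffOn ℝ ∞ F U ∧
      ∀ h : RealPoints A, RealPoints.coords a h ∈ U → f h = F (RealPoints.coords a h)

/-- Regular functions on `G(ℝ)`: restrictions to the rational points of elements of `A`. -/
def RealPoints.IsRegular (f : RealPoints A → ℝ) : Prop :=
  ∃ a : A, ∀ g : RealPoints A, f g = g.ofConv a

lemma RealPoints.IsRegular.isSmooth {f : RealPoints A → ℝ} (hf : RealPoints.IsRegular f) :
    RealPoints.IsSmooth f := by
  obtain ⟨a, ha⟩ := hf
  intro g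
  exact ⟨1, fun _ => a, Set.univ, fun x => x 0, isOpen_univ, Set.mem_univ _,
    (contDiff_apply ℝ ℝ (0 : Fin 1)).contDiffOn, fun h _ => ha h⟩

end RealPoints

/-! ### Representations of the Lie group of real points -/

section LieRep

variable (A : Type*) [CommRing A] [HopfAlgebra ℝ A]

/-- A finite-dimensional representation of the abstract group `G(ℝ)` is a representation of the
Lie group when `G(ℝ) → GL(E)` is smooth, i.e. its matrix coefficients are smooth. -/
def isLieRep : ObjectProperty (FDRep ℝ (RealPoints A)) := fun E =>
  ∀ (v : E) (φ : Module.Dual ℝ E), RealPoints.IsSmooth fun g => φ (E.ρ g v)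

/-- A representation is algebraic when `G(ℝ) → GL(E)` is regular, i.e. its matrix
coefficients are regular functions. -/
def isAlgebraicRep : ObjectProperty (FDRep ℝ (RealPoints A)) := fun E =>
  ∀ (v : E) (φ : Module.Dual ℝ E), RealPoints.IsRegular fun g => φ (E.ρ g v)

/-- The category of linear representations of the Lie group `G(ℝ)`. -/
abbrev LieRep : Type _ := (isLieRep A).FullSubcategory

/-- The category of algebraic linear representations of the Lie group `G(ℝ)`. -/
abbrev AlgebraicLieRep : Type _ := (isLieRep A ⊓ isAlgebraicRep A).FullSubcategory

end LieRep

/-! ### Representations of the affine group -/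

/-- A linear representation of the affine group `G = Spec A`: a finite-dimensional real vector
space `E` with a morphism of affine groups `G → GL(E)`, that is, a morphism of Hopf algebras
`ℝ[x_ij]_det → A`. Here `GL(E) = Spec ℝ[x_ij]_det` through the basis `Module.finBasis ℝ E`.
(A morphism of bialgebras between Hopf algebras commutes with the antipodes.) -/
structure AffineRep (A : Type*) [CommRing A] [HopfAlgebra ℝ A] where
  /-- The underlying vector space. -/
  E : Type
  [addCommGroup : AddCommGroup E]
  [module : Module ℝ E]
  [finite : Module.Finite ℝ E]
  /-- The morphism of Hopf algebras. -/
  ρ : GLCoord (Module.finrank ℝ E) →ₐc[ℝ] A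

namespace AffineRep

attribute [instance] addCommGroup module finite

variable {A : Type*} [CommRing A] [HopfAlgebra ℝ A]

/-- The matrix of regular functions on `G` giving the action in the basis
`Module.finBasis ℝ E`. -/
def matrix (V : AffineRep A) :
    Matrix (Fin (Module.finrank ℝ V.E)) (Fin (Module.finrank ℝ V.E)) A :=
  (GLCoord.X _).map V.ρ

/-- The matrix of a linear map, in the chosen bases and with entries seen in `A`. -/
def homMatrix (V W : AffineRep A) (f : V.E →ₗ[ℝ] W.E) :
    Matrix (Fin (Module.finrank ℝ W.E)) (Fin (Module.finrank ℝ V.E)) A :=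
  (LinearMap.toMatrix (Module.finBasis ℝ V.E) (Module.finBasis ℝ W.E) f).map (algebraMap ℝ A)

/-- Morphisms of representations of `G`: linear maps `f` such that the two morphisms of schemes
`g ↦ f ∘ ρ_V(g)` and `g ↦ ρ_W(g) ∘ f` from `G` to `Hom(V, W)` are equal. -/
@[ext]
structure Hom (V W : AffineRep A) where
  /-- The underlying linear map. -/
  toLinearMap : V.E →ₗ[ℝ] W.E
  comm : homMatrix V W toLinearMap * V.matrix = W.matrix * homMatrix V W toLinearMap

lemma homMatrix_id (V : AffineRep A) : homMatrix V V LinearMap.id = 1 := by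
  simp [homMatrix]

lemma homMatrix_comp {U V W : AffineRep A} (g : V.E →ₗ[ℝ] W.E) (f : U.E →ₗ[ℝ] V.E) :
    homMatrix U W (g ∘ₗ f) = homMatrix V W g * homMatrix U V f := by
  rw [homMatrix, LinearMap.toMatrix_comp _ (Module.finBasis ℝ V.E), Matrix.map_mul]
  rfl

instance : Category (AffineRep A) where
  Hom := Hom
  id V := ⟨LinearMap.id, by rw [homMatrix_id, one_mul, mul_one]⟩
  comp f g := ⟨g.toLinearMap ∘ₗ f.toLinearMap, by
    rw [homMatrix_comp, Matrix.mul_assoc, f.comm, ← Matrix.mul_assoc, g.comm, Matrix.mul_assoc]⟩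

lemma comul_matrix (V : AffineRep A) (i j) :
    Coalgebra.comul (R := ℝ) (V.matrix i j) =
      ∑ k, V.matrix i k ⊗ₜ[ℝ] V.matrix k j := by
  simp only [matrix, Matrix.map_apply]
  rw [← CoalgHomClass.map_comp_comul_apply, GLCoord.comul_X]
  simp

lemma counit_matrix (V : AffineRep A) (i j) :
    Coalgebra.counit (R := ℝ) (V.matrix i j) = (1 : Matrix _ _ ℝ) i j := by
  simp only [matrix, Matrix.map_apply]
  rw [CoalgHomClass.counit_comp_apply, GLCoord.counit_X]

/-- The action of the rational points: `g` acts by the matrix `(g(ρ* x_ij))`. -/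
def realRep (V : AffineRep A) : Representation ℝ (RealPoints A) V.E where
  toFun g := Matrix.toLin (Module.finBasis ℝ V.E) (Module.finBasis ℝ V.E) (V.matrix.map g.ofConv)
  map_one' := by
    have : V.matrix.map (1 : RealPoints A).ofConv = 1 := by
      ext i j
      have := counit_matrix V i j
      simpa using this
    rw [this, Matrix.toLin_one]
    rfl
  map_mul' g h := by
    have : V.matrix.map (g * h).ofConv = V.matrix.map g.ofConv * V.matrix.map h.ofConv := by
      ext i j
      rw [Matrix.map_apply, AlgHom.convMul_apply, comul_matrix]
      simp [Matrix.mul_apply]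
    rw [this, Matrix.toLin_mul _ (Module.finBasis ℝ V.E)]
    rfl

lemma realRep_isRegular (V : AffineRep A) (v : V.E) (φ : Module.Dual ℝ V.E) :
    RealPoints.IsRegular fun g : RealPoints A => φ (V.realRep g v) := by
  let b := Module.finBasis ℝ V.E
  refine ⟨∑ i, ∑ j, algebraMap ℝ A (b.repr v j * φ (b i)) * V.matrix i j, fun g => ?_⟩
  change φ (Matrix.toLin b b (V.matrix.map g.ofConv) v) = _
  rw [Matrix.toLin_apply]
  simp only [map_sum, map_smul, smul_eq_mul, Matrix.mulVec, dotProduct, Matrix.map_apply, map_mul,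
    AlgHom.commutes, Finset.sum_mul, Algebra.algebraMap_self, RingHom.id_apply]
  refine Finset.sum_congr rfl fun i _ => Finset.sum_congr rfl fun j _ => ?_
  ring

lemma realRep_comm {V W : AffineRep A} (f : Hom V W) (g : RealPoints A) :
    f.toLinearMap ∘ₗ V.realRep g = W.realRep g ∘ₗ f.toLinearMap := by
  have hmap : (homMatrix V W f.toLinearMap).map g.ofConv =
      LinearMap.toMatrix (Module.finBasis ℝ V.E) (Module.finBasis ℝ W.E) f.toLinearMap := by
    ext i j
    simp [homMatrix]
  have h := congrArg (fun M => M.map g.ofConv) f.comm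
  simp only [Matrix.map_mul, hmap] at h
  apply (LinearMap.toMatrix (Module.finBasis ℝ V.E) (Module.finBasis ℝ W.E)).injective
  rw [LinearMap.toMatrix_comp _ (Module.finBasis ℝ V.E),
    LinearMap.toMatrix_comp _ (Module.finBasis ℝ W.E)]
  simpa [realRep] using h

/-- Restriction of representations from `G` to the group `G(ℝ)`; on morphisms it is the
identity on the underlying linear maps. -/
def toFDRep (A : Type*) [CommRing A] [HopfAlgebra ℝ A] :
    AffineRep A ⥤ FDRep ℝ (RealPoints A) where
  obj V := FDRep.of V.realRep
  map {V W} f :=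
    { hom := FGModuleCat.ofHom f.toLinearMap
      comm := fun g => by
        ext v
        exact LinearMap.congr_fun (realRep_comm f g) v }
  map_id _ := rfl
  map_comp _ _ := rfl

/-- Every representation of `G` restricts to an algebraic representation of the Lie group
`G(ℝ)`, and every morphism to an equivariant linear map. -/
def restriction (A : Type*) [CommRing A] [HopfAlgebra ℝ A] :
    AffineRep A ⥤ AlgebraicLieRep A :=
  ObjectProperty.lift _ (toFDRep A) fun V =>
    ⟨fun v φ => (realRep_isRegular V v φ).isSmooth, fun v φ => realRep_isRegular V v φ⟩

end AffineRep

end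

/-! Everything reduces to density: a regular function vanishing on `G(ℝ)` is zero. Given this,
identities in `A` and in `A ⊗ A` may be tested on real points. A regular matrix representation of
`G(ℝ)` then has entries with unique lifts to `A`, and these satisfy the comultiplication and counit
identities (essential surjectivity). A linear map commuting with all real points also commutes with
the universal matrices (fullness).

For density, let `I` be the ideal of functions vanishing on `G(ℝ)` and `m` the augmentation ideal. A
point derivation `D` acts locally finitely on `A`, so `exp(tD)` converges and is a real point for
every real `t`. If `a ∈ I ∩ m^n` has leading form `F`, evaluating along these curves gives `F = 0`;
hence `I ⊆ m^n` for all `n` (`vanishingIdeal_le_pow`). Krull's intersection theorem and Nakayama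
give `f ∈ m` acting as the identity on `I`. Translating `f` by all real points yields `I = I²`
(`isIdempotentElem_vanishingIdeal`), so `I` is generated by an idempotent `e`. The clopen set where
`e ≠ 0` has no real point, hence is empty, and `e = 0`. No reducedness or smoothness of `A` is
presupposed.

For `Gl_1`, an equivalence would preserve the property that every morphism has a generalized
inverse. It holds for `Rep(Gl_1)` by the weight decomposition, and fails for the nilpotent
endomorphism of `t ↦ [1, log |t|; 0, 1]`. -/

noncomputable section

/-! ### Translation operators attached to functionals -/

section Translation

open Coalgebra

/-- The slice map `v ⊗ w ↦ φ(w) v`. -/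
def sliceRight {V W : Type*} [AddCommGroup V] [Module ℝ V] [AddCommGroup W] [Module ℝ W]
    (φ : W →ₗ[ℝ] ℝ) : V ⊗[ℝ] W →ₗ[ℝ] V :=
  (TensorProduct.rid ℝ V).toLinearMap ∘ₗ φ.lTensor V

@[simp]
lemma sliceRight_tmul {V W : Type*} [AddCommGroup V] [Module ℝ V] [AddCommGroup W] [Module ℝ W]
    (φ : W →ₗ[ℝ] ℝ) (v : V) (w : W) : sliceRight φ (v ⊗ₜ[ℝ] w) = φ w • v := by
  simp [sliceRight]

variable {A : Type*} [CommRing A] [HopfAlgebra ℝ A]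

/-- The operator `a ↦ ∑ φ(a₂) a₁` of `A` attached to a functional `φ`. -/
def translateBy (φ : A →ₗ[ℝ] ℝ) : A →ₗ[ℝ] A := sliceRight φ ∘ₗ comul

lemma translateBy_eq_sum (φ : A →ₗ[ℝ] ℝ) {a : A} {ι : Type*} (r : Coalgebra.Repr ℝ a ι) :
    translateBy φ a = ∑ i ∈ r.index, φ (r.right i) • r.left i := by
  rw [translateBy, LinearMap.comp_apply, ← r.eq]
  simp

lemma translateBy_counit (a : A) : translateBy (counit (R := ℝ) (A := A)) a = a := by
  simp [translateBy, sliceRight]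

lemma counit_translateBy (φ : A →ₗ[ℝ] ℝ) (a : A) :
    counit (R := ℝ) (translateBy φ a) = φ a := by
  rw [translateBy_eq_sum φ (ℛ ℝ a)]
  conv_rhs => rw [← sum_counit_smul (ℛ ℝ a)]
  simp [mul_comm]

/-- Coassociativity: the dual of `A`, with convolution, acts on `A`. -/
lemma translateBy_translateBy (φ ψ : A →ₗ[ℝ] ℝ) (a : A) :
    translateBy φ (translateBy ψ a) =
      translateBy (LinearMap.mul' ℝ ℝ ∘ₗ TensorProduct.map φ ψ ∘ₗ comul) a := by
  have h₁ (t : (A ⊗[ℝ] A) ⊗[ℝ] A) : sliceRight φ (sliceRight ψ t) =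
      sliceRight (LinearMap.mul' ℝ ℝ ∘ₗ TensorProduct.map φ ψ)
        (TensorProduct.assoc ℝ A A A t) := by
    induction t with
    | zero => simp
    | add x y hx hy => simp only [map_add, hx, hy]
    | tmul x c =>
      induction x with
      | zero => simp
      | add x y hx hy => simp only [map_add, TensorProduct.add_tmul, hx, hy]
      | tmul x y => simp [smul_smul, mul_comm]
  have h₂ (t : A ⊗[ℝ] A) :
      comul (R := ℝ) (sliceRight ψ t) = sliceRight ψ (comul.rTensor A t) := by
    induction t with
    | zero => simp
    | add x y hx hy => simp only [map_add, hx, hy]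
    | tmul x y => simp
  have h₃ (t : A ⊗[ℝ] A) :
      sliceRight (LinearMap.mul' ℝ ℝ ∘ₗ TensorProduct.map φ ψ) (comul.lTensor A t) =
        sliceRight (LinearMap.mul' ℝ ℝ ∘ₗ TensorProduct.map φ ψ ∘ₗ comul) t := by
    induction t with
    | zero => simp
    | add x y hx hy => simp only [map_add, hx, hy]
    | tmul x y => simp
  simp only [translateBy, LinearMap.comp_apply]
  rw [h₂, h₁, coassoc_apply, h₃]

/-- The translates of `a` by all functionals. -/
def translates (a : A) : Submodule ℝ A :=
  LinearMap.range
    ({ toFun φ := translateBy φ a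
       map_add' φ ψ := by simp [translateBy_eq_sum _ (ℛ ℝ a), add_smul, Finset.sum_add_distrib]
       map_smul' c φ := by simp [translateBy_eq_sum _ (ℛ ℝ a), mul_smul, Finset.smul_sum] } :
      (A →ₗ[ℝ] ℝ) →ₗ[ℝ] A)

lemma mem_translates {a b : A} : b ∈ translates a ↔ ∃ φ, translateBy φ a = b := Iff.rfl

lemma self_mem_translates (a : A) : a ∈ translates a := ⟨counit, translateBy_counit a⟩

lemma translateBy_mem_translates (φ : A →ₗ[ℝ] ℝ) {a b : A} (hb : b ∈ translates a) :
    translateBy φ b ∈ translates a := by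
  obtain ⟨ψ, rfl⟩ := mem_translates.1 hb
  exact ⟨_, (translateBy_translateBy φ ψ a).symm⟩

/-- Local finiteness: every translate is a combination of the finitely many left factors of one
expression of `comul a`. -/
instance (a : A) : FiniteDimensional ℝ (translates a) := by
  have h : translates a ≤ Submodule.span ℝ ((ℛ ℝ a).left '' (ℛ ℝ a).index) := by
    rintro _ ⟨φ, rfl⟩
    change translateBy φ a ∈ _
    rw [translateBy_eq_sum φ (ℛ ℝ a)]
    exact Submodule.sum_mem _ fun i hi => Submodule.smul_mem _ _
      (Submodule.subset_span ⟨i, hi, rfl⟩)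
  have : FiniteDimensional ℝ (Submodule.span ℝ ((ℛ ℝ a).left '' (ℛ ℝ a).index)) :=
    FiniteDimensional.span_of_finite ℝ ((Finset.finite_toSet _).image _)
  exact Submodule.finiteDimensional_of_le h

lemma sliceRight_mul (φ ψ : A →ₗ[ℝ] ℝ) (D : A →ₗ[ℝ] ℝ)
    (h : ∀ a b, D (a * b) = φ a * D b + D a * ψ b) (s t : A ⊗[ℝ] A) :
    sliceRight D (s * t) = sliceRight φ s * sliceRight D t + sliceRight D s * sliceRight ψ t := by
  induction s with
  | zero => simp
  | add x y hx hy => simp only [map_add, add_mul, hx, hy]; ring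
  | tmul a b =>
    induction t with
    | zero => simp
    | add x y hx hy => simp only [map_add, mul_add, hx, hy]; ring
    | tmul c d => simp [h, add_smul, smul_smul, mul_comm (D _)]

lemma translateBy_mul (φ ψ : A →ₗ[ℝ] ℝ) (D : A →ₗ[ℝ] ℝ)
    (h : ∀ a b, D (a * b) = φ a * D b + D a * ψ b) (a b : A) :
    translateBy D (a * b) = translateBy φ a * translateBy D b + translateBy D a * translateBy ψ b := by
  simp only [translateBy, LinearMap.comp_apply, Bialgebra.comul_mul]
  exact sliceRight_mul φ ψ D h _ _

/-- A point derivation of `A` at the neutral element. -/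
def IsPointDerivation (D : A →ₗ[ℝ] ℝ) : Prop :=
  ∀ a b, D (a * b) = counit (R := ℝ) a * D b + D a * counit (R := ℝ) b

lemma IsPointDerivation.translateBy_mul {D : A →ₗ[ℝ] ℝ} (hD : IsPointDerivation D) (a b : A) :
    translateBy D (a * b) = a * translateBy D b + translateBy D a * b := by
  rw [_root_.translateBy_mul counit counit D hD, translateBy_counit, translateBy_counit]

end Translation

/-! ### Powers of derivations -/

/-- The Leibniz rule says that multiplication intertwines `X ⊗ 1 + 1 ⊗ X` with `X`; the two summands
commute, so the binomial theorem applies. -/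
lemma pow_derivation_mul {R : Type*} [CommRing R] [Algebra ℝ R] (X : R →ₗ[ℝ] R)
    (hX : ∀ a b, X (a * b) = a * X b + X a * b) (n : ℕ) (a b : R) :
    (X ^ n) (a * b) = ∑ p ∈ Finset.HasAntidiagonal.antidiagonal n,
      (n.choose p.1 : ℝ) • ((X ^ p.1) a * (X ^ p.2) b) := by
  have hcomm : Commute (X.rTensor R : Module.End ℝ (R ⊗[ℝ] R)) (X.lTensor R) := by
    refine TensorProduct.ext' fun x y => ?_
    simp
  have h (t : R ⊗[ℝ] R) : (X ^ n) (LinearMap.mul' ℝ R t) =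
      LinearMap.mul' ℝ R (((X.rTensor R + X.lTensor R : Module.End ℝ (R ⊗[ℝ] R)) ^ n) t) := by
    induction n generalizing t with
    | zero => simp
    | succ n ih =>
      rw [pow_succ, Module.End.mul_apply, pow_succ, Module.End.mul_apply, ← ih]
      congr 1
      induction t with
      | zero => simp
      | add x y hx hy => simp only [map_add, hx, hy]
      | tmul x y => simp [hX, add_comm]
  have := h (a ⊗ₜ[ℝ] b)
  rw [hcomm.add_pow'] at this
  rw [LinearMap.mul'_apply] at this
  rw [this, LinearMap.sum_apply, map_sum]
  refine Finset.sum_congr rfl fun p _ => ?_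
  rw [LinearMap.smul_apply, map_nsmul, Module.End.mul_apply, LinearMap.lTensor_pow,
    LinearMap.rTensor_pow, LinearMap.lTensor_tmul, LinearMap.rTensor_tmul, LinearMap.mul'_apply,
    Nat.cast_smul_eq_nsmul]

/-- On the invariant finite-dimensional `W`, powers of `X` are controlled by an operator norm. This
makes the exponential series converge. -/
lemma exists_bound_pow_of_mem {V : Type*} [AddCommGroup V] [Module ℝ V] (X : V →ₗ[ℝ] V)
    (ε : V →ₗ[ℝ] ℝ) (W : Submodule ℝ V) [FiniteDimensional ℝ W] (hW : ∀ w ∈ W, X w ∈ W) {w : V}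
    (hw : w ∈ W) : ∃ C M : ℝ, ∀ n, ‖ε ((X ^ n) w)‖ ≤ C * M ^ n := by
  let e := (Module.finBasis ℝ W).equivFun
  let T : (Fin (Module.finrank ℝ W) → ℝ) →L[ℝ] (Fin (Module.finrank ℝ W) → ℝ) :=
    LinearMap.toContinuousLinearMap (e.toLinearMap ∘ₗ X.restrict hW ∘ₗ e.symm.toLinearMap)
  let E : (Fin (Module.finrank ℝ W) → ℝ) →L[ℝ] ℝ :=
    LinearMap.toContinuousLinearMap (ε ∘ₗ W.subtype ∘ₗ e.symm.toLinearMap)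
  have h (n : ℕ) : (e.symm ((T ^ n) (e ⟨w, hw⟩)) : V) = (X ^ n) w := by
    induction n with
    | zero => simp
    | succ n ih =>
      rw [pow_succ', pow_succ', Module.End.mul_apply, ← ih]
      simp [T]
  refine ⟨‖E‖ * ‖e ⟨w, hw⟩‖, ‖T‖, fun n => ?_⟩
  have hT : ‖(T ^ n) (e ⟨w, hw⟩)‖ ≤ ‖T‖ ^ n * ‖e ⟨w, hw⟩‖ := by
    induction n with
    | zero => simp
    | succ n ih =>
      rw [pow_succ', pow_succ', mul_assoc]
      exact (T.le_opNorm _).trans (mul_le_mul_of_nonneg_left ih (norm_nonneg _))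
  calc ‖ε ((X ^ n) w)‖ = ‖E ((T ^ n) (e ⟨w, hw⟩))‖ := by rw [← h]; rfl
    _ ≤ ‖E‖ * (‖T‖ ^ n * ‖e ⟨w, hw⟩‖) := (E.le_opNorm _).trans (by gcongr)
    _ = _ := by ring

/-! ### One-parameter subgroups -/

section OneParameter

open Coalgebra

variable {A : Type*} [CommRing A] [HopfAlgebra ℝ A] {D : A →ₗ[ℝ] ℝ}

/-- The coefficients of the Taylor series of `t ↦ exp(tD)(a)`. -/
def expCoeff (D : A →ₗ[ℝ] ℝ) (a : A) (n : ℕ) : ℝ :=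
  (n.factorial : ℝ)⁻¹ * counit (R := ℝ) ((translateBy D ^ n) a)

lemma summable_norm_expCoeff (D : A →ₗ[ℝ] ℝ) (a : A) (t : ℝ) :
    Summable fun n => ‖t ^ n * expCoeff D a n‖ := by
  obtain ⟨C, M, h⟩ := exists_bound_pow_of_mem (translateBy D) counit (translates a)
    (fun _ => translateBy_mem_translates D) (self_mem_translates a)
  refine Summable.of_nonneg_of_le (fun _ => norm_nonneg _) (fun n => ?_)
    ((Real.summable_pow_div_factorial (|t| * M)).mul_left C)
  rw [expCoeff, norm_mul, norm_mul, norm_pow, norm_inv, Real.norm_natCast]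
  calc ‖t‖ ^ n * ((n.factorial : ℝ)⁻¹ * ‖counit (R := ℝ) ((translateBy D ^ n) a)‖)
      ≤ ‖t‖ ^ n * ((n.factorial : ℝ)⁻¹ * (C * M ^ n)) := by gcongr; exact h n
    _ = _ := by rw [Real.norm_eq_abs]; ring

lemma IsPointDerivation.expCoeff_mul (hD : IsPointDerivation D) (a b : A) (n : ℕ) :
    expCoeff D (a * b) n = ∑ p ∈ Finset.HasAntidiagonal.antidiagonal n,
      expCoeff D a p.1 * expCoeff D b p.2 := by
  rw [expCoeff, pow_derivation_mul _ hD.translateBy_mul, map_sum, Finset.mul_sum]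
  refine Finset.sum_congr rfl fun p hp => ?_
  obtain rfl := Finset.HasAntidiagonal.mem_antidiagonal.1 hp
  rw [map_smul, Bialgebra.counit_mul, smul_eq_mul, Nat.cast_add_choose, expCoeff, expCoeff]
  have := Nat.factorial_ne_zero (p.1 + p.2)
  field_simp

lemma IsPointDerivation.translateBy_one (hD : IsPointDerivation D) :
    translateBy D 1 = 0 := by
  have := hD.translateBy_mul 1 1
  simpa using this

lemma IsPointDerivation.expCoeff_one (hD : IsPointDerivation D) (n : ℕ) :
    expCoeff D 1 n = if n = 0 then 1 else 0 := by
  cases n with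
  | zero => simp [expCoeff]
  | succ n => simp [expCoeff, pow_succ, hD.translateBy_one]

lemma expCoeff_zero (D : A →ₗ[ℝ] ℝ) (a : A) : expCoeff D a 0 = counit (R := ℝ) a := by
  simp [expCoeff]

lemma expCoeff_one_eq (D : A →ₗ[ℝ] ℝ) (a : A) : expCoeff D a 1 = D a := by
  simp [expCoeff, counit_translateBy]

/-- The one-parameter subgroup `t ↦ exp(tD)` of the group of real points. -/
def IsPointDerivation.exp (hD : IsPointDerivation D) (t : ℝ) : A →ₐ[ℝ] ℝ :=
  AlgHom.ofLinearMap
    { toFun a := ∑' n, t ^ n * expCoeff D a n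
      map_add' a b := by
        rw [← (summable_norm_expCoeff D a t).of_norm.tsum_add
          (summable_norm_expCoeff D b t).of_norm]
        simp [expCoeff, mul_add]
      map_smul' c a := by
        rw [RingHom.id_apply, smul_eq_mul, ← tsum_mul_left]
        refine tsum_congr fun n => ?_
        simp only [expCoeff, map_smul, smul_eq_mul]
        ring }
    (by
      change ∑' n, t ^ n * expCoeff D 1 n = 1
      simp [hD.expCoeff_one])
    (fun a b => by
      change ∑' n, t ^ n * expCoeff D (a * b) n =
        (∑' n, t ^ n * expCoeff D a n) * ∑' n, t ^ n * expCoeff D b n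
      rw [tsum_mul_tsum_eq_tsum_sum_antidiagonal_of_summable_norm
        (summable_norm_expCoeff D a t) (summable_norm_expCoeff D b t)]
      refine tsum_congr fun n => ?_
      rw [hD.expCoeff_mul, Finset.mul_sum]
      refine Finset.sum_congr rfl fun p hp => ?_
      rw [← Finset.HasAntidiagonal.mem_antidiagonal.1 hp]
      ring)

lemma IsPointDerivation.hasSum_exp (hD : IsPointDerivation D) (t : ℝ) (a : A) :
    HasSum (fun n => t ^ n * expCoeff D a n) (hD.exp t a) :=
  (summable_norm_expCoeff D a t).of_norm.hasSum

lemma IsPointDerivation.exp_zero (hD : IsPointDerivation D) (a : A) :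
    hD.exp 0 a = counit (R := ℝ) a := by
  have h := hD.hasSum_exp 0 a
  refine h.unique ?_
  convert! hasSum_single 0 fun n hn => ?_
  · simp [expCoeff_zero]
  · simp [hn]

lemma IsPointDerivation.hasDerivAt_exp (hD : IsPointDerivation D) (a : A) :
    HasDerivAt (fun t => hD.exp t a) (D a) 0 := by
  let p : FormalMultilinearSeries ℝ ℝ ℝ := fun n =>
    ContinuousMultilinearMap.mkPiRing ℝ (Fin n) (expCoeff D a n)
  have hp (n : ℕ) : p.coeff n = expCoeff D a n := by simp [p, FormalMultilinearSeries.coeff]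
  have h : HasFPowerSeriesAt (fun t => hD.exp t a) p 0 := by
    rw [hasFPowerSeriesAt_iff]
    refine Filter.Eventually.of_forall fun t => ?_
    simpa [hp] using hD.hasSum_exp t a
  simpa [p, expCoeff_one_eq] using h.hasDerivAt

end OneParameter

lemma MvPolynomial.IsHomogeneous.eval_const_mul {σ R : Type*} [Fintype σ] [CommRing R]
    {F : MvPolynomial σ R} {n : ℕ} (hF : F.IsHomogeneous n) (c : R) (x : σ → R) :
    MvPolynomial.eval (fun i => c * x i) F = c ^ n * MvPolynomial.eval x F := by
  simp only [MvPolynomial.eval_eq', Finset.mul_sum, mul_pow, Finset.prod_mul_distrib]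
  refine Finset.sum_congr rfl fun d hd => ?_
  have := hF (MvPolynomial.mem_support_iff.1 hd)
  rw [Finsupp.weight_apply, Finsupp.sum_fintype _ _ (by simp)] at this
  simp only [Pi.one_apply, smul_eq_mul, mul_one] at this
  rw [Finset.prod_pow_eq_pow_sum, this]
  ring

/-! ### Functions vanishing on the rational points -/

section VanishingIdeal

open Coalgebra Filter Topology Asymptotics

variable (A : Type*) [CommRing A] [HopfAlgebra ℝ A]

/-- The ideal of the regular functions vanishing at all rational points. -/
def vanishingIdeal : Ideal A := ⨅ g : RealPoints A, RingHom.ker g.ofConv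

/-- The ideal of the regular functions vanishing at the neutral element. -/
def augmentationIdeal : Ideal A := RingHom.ker (Bialgebra.counitAlgHom ℝ A)

variable {A}

lemma mem_vanishingIdeal {a : A} : a ∈ vanishingIdeal A ↔ ∀ g : RealPoints A, g.ofConv a = 0 := by
  simp [vanishingIdeal, RingHom.mem_ker]

lemma mem_augmentationIdeal {a : A} : a ∈ augmentationIdeal A ↔ counit (R := ℝ) a = 0 :=
  Iff.rfl

lemma sub_counit_mem_augmentationIdeal (a : A) :
    a - algebraMap ℝ A (counit (R := ℝ) a) ∈ augmentationIdeal A := by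
  simp [mem_augmentationIdeal]

/-- Expand `ψ` on the product of `a - ε(a)` and `b - ε(b)`, which lies in the square of the
augmentation ideal. -/
lemma isPointDerivation_of_vanish_sq (ψ : A →ₗ[ℝ] ℝ) (h₁ : ψ 1 = 0)
    (h : ∀ a ∈ augmentationIdeal A ^ 2, ψ a = 0) : IsPointDerivation ψ := by
  intro a b
  have := h _ (by
    rw [pow_two]
    exact Ideal.mul_mem_mul (sub_counit_mem_augmentationIdeal a)
      (sub_counit_mem_augmentationIdeal b))
  simp only [sub_mul, mul_sub, map_sub, map_smul,
    smul_eq_mul, Algebra.algebraMap_eq_smul_one, mul_one, h₁, smul_mul_assoc, mul_smul_comm,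
    one_mul, mul_zero, sub_zero] at this
  linarith

/-- Coordinates at the neutral element: functions lifting a basis of the cotangent space. -/
lemma exists_cotangent_coordinates (A : Type*) [CommRing A] [HopfAlgebra ℝ A]
    [IsNoetherianRing A] :
    ∃ (d : ℕ) (x : Fin d → A), (∀ i, x i ∈ augmentationIdeal A) ∧
      (∀ a ∈ augmentationIdeal A, ∃ c : Fin d → ℝ,
        a - ∑ i, c i • x i ∈ augmentationIdeal A ^ 2) ∧
      ∀ u : Fin d → ℝ, ∃ D : A →ₗ[ℝ] ℝ, IsPointDerivation D ∧ ∀ i, D (x i) = u i := by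
  set m := augmentationIdeal A
  let q := ((m ^ 2).restrictScalars ℝ).mkQ
  have hq {a : A} : q a = 0 ↔ a ∈ m ^ 2 := by simp [q]
  let V := (m.restrictScalars ℝ).map q
  obtain ⟨s, hs⟩ := (isNoetherianRing_iff_ideal_fg A).1 inferInstance m
  have hV : V ≤ Submodule.span ℝ (q '' s) := by
    rintro _ ⟨a, ha, rfl⟩
    change a ∈ m at ha
    rw [← hs] at ha
    rw [← Submodule.map_span]
    induction ha using Submodule.span_induction with
    | mem x hx => exact ⟨x, Submodule.subset_span hx, rfl⟩
    | zero => simp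
    | add x y _ _ hx hy => rw [map_add]; exact add_mem hx hy
    | smul a x hx' hx =>
      -- `A` acts on `m / m²` through the counit, so ideal generators of `m` span it over `ℝ`.
      have h : q (a • x) = counit (R := ℝ) a • q x := by
        rw [← map_smul, ← sub_eq_zero, ← map_sub, hq, pow_two, smul_eq_mul, Algebra.smul_def,
          ← sub_mul]
        exact Ideal.mul_mem_mul (sub_counit_mem_augmentationIdeal a) (hs ▸ hx')
      rw [h]
      exact Submodule.smul_mem _ _ hx
  have : FiniteDimensional ℝ (Submodule.span ℝ (q '' (s : Set A))) :=
    FiniteDimensional.span_of_finite ℝ (s.finite_toSet.image _)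
  have : FiniteDimensional ℝ V := Submodule.finiteDimensional_of_le hV
  let b := Module.finBasis ℝ V
  have hx (i) : ∃ a ∈ m, q a = b i := (b i).2
  choose x hxm hxq using hx
  refine ⟨_, x, hxm, fun a ha => ⟨b.repr ⟨q a, a, ha, rfl⟩, ?_⟩, fun u => ?_⟩
  · rw [← hq, map_sub, map_sum, sub_eq_zero]
    have h := congrArg V.subtype (b.sum_repr ⟨q a, a, ha, rfl⟩)
    rw [map_sum] at h
    refine h.symm.trans (Finset.sum_congr rfl fun i _ => ?_)
    rw [map_smul, map_smul, hxq, Submodule.subtype_apply]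
  · obtain ⟨f, hf⟩ := (b.constr ℝ u).exists_extend
    -- Subtracting the value at the neutral element projects `A` onto `m` and kills constants.
    let D : A →ₗ[ℝ] ℝ := f ∘ₗ q ∘ₗ (LinearMap.id - Algebra.linearMap ℝ A ∘ₗ counit)
    have hD {a : A} (ha : a ∈ m) : D a = f (q a) := by
      have : counit (R := ℝ) a = 0 := ha
      simp [D, this]
    refine ⟨D, isPointDerivation_of_vanish_sq D (by simp [D]) fun a ha => ?_, fun i => ?_⟩
    · rw [hD (Ideal.pow_le_self two_ne_zero ha), hq.2 ha, map_zero]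
    · rw [hD (hxm i), hxq]
      have := LinearMap.congr_fun hf (b i)
      simpa using this

/-- Approximation of functions vanishing to order `n` by homogeneous polynomials in coordinates. -/
lemma exists_homogeneous_sub_mem {d : ℕ} {x : Fin d → A} (hx : ∀ i, x i ∈ augmentationIdeal A)
    (hspan : ∀ a ∈ augmentationIdeal A, ∃ c : Fin d → ℝ,
        a - ∑ i, c i • x i ∈ augmentationIdeal A ^ 2) (n : ℕ) {a : A}
    (ha : a ∈ augmentationIdeal A ^ n) : ∃ F : MvPolynomial (Fin d) ℝ, F.IsHomogeneous n ∧
      a - MvPolynomial.aeval x F ∈ augmentationIdeal A ^ (n + 1) := by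
  induction n generalizing a with
  | zero =>
    refine ⟨MvPolynomial.C (counit (R := ℝ) a), MvPolynomial.isHomogeneous_C _ _, ?_⟩
    simpa using sub_counit_mem_augmentationIdeal a
  | succ n ih =>
    rw [pow_succ] at ha
    induction ha using Submodule.mul_induction_on' with
    | mem_mul_mem a ha b hb =>
      obtain ⟨F, hF, haF⟩ := ih ha
      obtain ⟨c, hc⟩ := hspan b hb
      refine ⟨F * ∑ i, MvPolynomial.C (c i) * MvPolynomial.X i, hF.mul
        (MvPolynomial.IsHomogeneous.sum _ _ _ fun i _ =>
          MvPolynomial.isHomogeneous_C_mul_X _ _), ?_⟩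
      have h : a * b - MvPolynomial.aeval x (F * ∑ i, MvPolynomial.C (c i) * MvPolynomial.X i) =
          a * (b - ∑ i, c i • x i) +
            (a - MvPolynomial.aeval x F) * ∑ i, c i • x i := by
        simp only [map_mul, map_sum, MvPolynomial.aeval_C, MvPolynomial.aeval_X, Algebra.smul_def]
        ring
      rw [h]
      refine add_mem ?_ ?_
      · rw [add_assoc, pow_add]
        exact Ideal.mul_mem_mul ha hc
      · rw [pow_succ]
        refine Ideal.mul_mem_mul haF (sum_mem fun i _ => ?_)
        rw [Algebra.smul_def]
        exact Ideal.mul_mem_left _ _ (hx i)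
    | add a ha b hb ha' hb' =>
      obtain ⟨F, hF, haF⟩ := ha'
      obtain ⟨G, hG, hbG⟩ := hb'
      refine ⟨F + G, hF.add hG, ?_⟩
      rw [map_add, add_sub_add_comm]
      exact add_mem haF hbG

/-- Each factor in `m` vanishes at `t = 0` and is differentiable there, so it contributes one power
of `t`. -/
lemma IsPointDerivation.exp_isBigO {D : A →ₗ[ℝ] ℝ} (hD : IsPointDerivation D) (n : ℕ) {a : A}
    (ha : a ∈ augmentationIdeal A ^ n) : (fun t => hD.exp t a) =O[𝓝 0] fun t => t ^ n := by
  induction n generalizing a with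
  | zero =>
    simpa using (hD.hasDerivAt_exp a).continuousAt.isBigO_one ℝ
  | succ n ih =>
    rw [pow_succ] at ha
    induction ha using Submodule.mul_induction_on' with
    | mem_mul_mem a ha b hb =>
      have h := (hD.hasDerivAt_exp b).isBigO_sub
      simp only [hD.exp_zero, mem_augmentationIdeal.1 hb, sub_zero] at h
      simpa [pow_succ] using (ih ha).mul h
    | add a ha b hb ha' hb' => simpa using ha'.add hb'

/-- The leading form `F` of a function vanishing on `G(ℝ)` vanishes at every tangent vector `u`:
compute the limit of `F(x(exp tD)) / t^n` in two ways, where `D` has coordinates `u`. -/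
lemma vanishingIdeal_le_pow [IsNoetherianRing A] (n : ℕ) :
    vanishingIdeal A ≤ augmentationIdeal A ^ n := by
  obtain ⟨d, x, hx, hspan, hder⟩ := exists_cotangent_coordinates A
  induction n with
  | zero => simp
  | succ n ih =>
    intro a ha
    obtain ⟨F, hF, haF⟩ := exists_homogeneous_sub_mem hx hspan n (ih ha)
    suffices F = 0 by simpa [this] using haF
    refine MvPolynomial.funext fun u => ?_
    obtain ⟨D, hD, hDu⟩ := hder u
    -- The coordinates of `exp(tD)` vanish at `t = 0` with derivative `u`.
    have h₁ : Tendsto (fun t : ℝ => MvPolynomial.eval (fun i => t⁻¹ * hD.exp t (x i)) F)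
        (𝓝[≠] 0) (𝓝 (MvPolynomial.eval u F)) := by
      refine (MvPolynomial.continuous_eval F).continuousAt.tendsto.comp
        (tendsto_pi_nhds.2 fun i => ?_)
      have := hasDerivAt_iff_tendsto_slope.1 (hD.hasDerivAt_exp (x i))
      rw [hDu] at this
      refine this.congr fun t => ?_
      simp [slope, hD.exp_zero, mem_augmentationIdeal.1 (hx i)]
    have h₂ : Tendsto (fun t : ℝ => MvPolynomial.eval (fun i => t⁻¹ * hD.exp t (x i)) F)
        (𝓝[≠] 0) (𝓝 0) := by
      have h₃ : (fun t : ℝ => MvPolynomial.eval (fun i => t⁻¹ * hD.exp t (x i)) F)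
          =O[𝓝[≠] 0] fun t => t := by
        -- Since `a` vanishes at `exp(tD)`, the value of `F(x)` there is minus that of `a - F(x) ∈
        -- m^(n+1)`; dividing by `t^n` leaves `O(t)`.
        have := ((isBigO_refl (fun t : ℝ => (t ^ n)⁻¹) (𝓝[≠] 0)).mul
          ((hD.exp_isBigO (n + 1) haF).mono nhdsWithin_le_nhds)).neg_left
        refine (this.congr' ?_ ?_)
        · filter_upwards [self_mem_nhdsWithin] with t ht
          have h0 : hD.exp t a = 0 := mem_vanishingIdeal.1 ha (WithConv.toConv (hD.exp t))
          have h4 : MvPolynomial.eval (fun i => t⁻¹ * hD.exp t (x i)) F =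
              t⁻¹ ^ n * MvPolynomial.eval (fun i => hD.exp t (x i)) F :=
            hF.eval_const_mul _ _
          have h5 : hD.exp t (MvPolynomial.aeval x F) =
              MvPolynomial.eval (fun i => hD.exp t (x i)) F := by
            rw [← AlgHom.comp_apply, MvPolynomial.comp_aeval]
            rfl
          rw [map_sub, h0, h5, h4, inv_pow]
          ring
        · filter_upwards [self_mem_nhdsWithin] with t ht
          have : t ≠ 0 := ht
          rw [pow_succ, inv_mul_cancel_left₀ (pow_ne_zero n this)]
      exact h₃.trans_tendsto (tendsto_nhdsWithin_of_tendsto_nhds tendsto_id)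
    simpa using tendsto_nhds_unique h₁ h₂

end VanishingIdeal

/-! ### Density of the rational points -/

section Density

open Coalgebra

variable {A : Type*} [CommRing A] [HopfAlgebra ℝ A]

lemma sliceRight_algHom_mul (h : A →ₐ[ℝ] ℝ) (s t : A ⊗[ℝ] A) :
    sliceRight h.toLinearMap (s * t) =
      sliceRight h.toLinearMap s * sliceRight h.toLinearMap t := by
  induction s with
  | zero => simp
  | add x y hx hy => simp only [map_add, add_mul, hx, hy]
  | tmul a b =>
    induction t with
    | zero => simp
    | add x y hx hy => simp only [map_add, mul_add, hx, hy]
    | tmul c d => simp [smul_smul, mul_comm (h d)]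

lemma translateBy_algHom_mul (h : A →ₐ[ℝ] ℝ) (a b : A) :
    translateBy h.toLinearMap (a * b) =
      translateBy h.toLinearMap a * translateBy h.toLinearMap b := by
  simp only [translateBy, LinearMap.comp_apply, Bialgebra.comul_mul, sliceRight_algHom_mul]

lemma RealPoints.mul_apply (g h : RealPoints A) (a : A) :
    (g * h).ofConv a = LinearMap.mul' ℝ ℝ (TensorProduct.map g.ofConv.toLinearMap
      h.ofConv.toLinearMap (comul (R := ℝ) a)) := by
  rw [AlgHom.convMul_apply]
  induction comul (R := ℝ) a with
  | zero => simp
  | add x y hx hy => simp only [map_add, hx, hy]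
  | tmul x y => simp

lemma RealPoints.apply_translateBy (g h : RealPoints A) (a : A) :
    g.ofConv (translateBy h.ofConv.toLinearMap a) = (g * h).ofConv a := by
  rw [RealPoints.mul_apply, translateBy, LinearMap.comp_apply]
  induction comul (R := ℝ) a with
  | zero => simp
  | add x y hx hy => simp only [map_add, hx, hy]
  | tmul x y => simp [mul_comm]

lemma RealPoints.one_ofConv_apply (a : A) :
    (1 : RealPoints A).ofConv a = counit (R := ℝ) a := by
  simp

lemma RealPoints.inv_ofConv_apply (g : RealPoints A) (a : A) :
    g⁻¹.ofConv a = g.ofConv (HopfAlgebra.antipode ℝ a) := rfl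

lemma translateBy_translateBy_inv (h : RealPoints A) (a : A) :
    translateBy h.ofConv.toLinearMap (translateBy h⁻¹.ofConv.toLinearMap a) = a := by
  have : LinearMap.mul' ℝ ℝ ∘ₗ TensorProduct.map h.ofConv.toLinearMap
      h⁻¹.ofConv.toLinearMap ∘ₗ comul = counit (R := ℝ) (A := A) := by
    ext a
    rw [LinearMap.comp_apply, LinearMap.comp_apply, ← RealPoints.mul_apply, mul_inv_cancel,
      RealPoints.one_ofConv_apply]
  rw [translateBy_translateBy, this, translateBy_counit]

lemma translateBy_mem_vanishingIdeal (h : RealPoints A) {a : A} (ha : a ∈ vanishingIdeal A) :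
    translateBy h.ofConv.toLinearMap a ∈ vanishingIdeal A :=
  mem_vanishingIdeal.2 fun g => by rw [g.apply_translateBy, mem_vanishingIdeal.1 ha]

lemma antipode_mem_vanishingIdeal {a : A} (ha : a ∈ vanishingIdeal A) :
    HopfAlgebra.antipode ℝ a ∈ vanishingIdeal A :=
  mem_vanishingIdeal.2 fun g => by rw [← g.inv_ofConv_apply, mem_vanishingIdeal.1 ha]

/-- Expand `u` along a basis of `V`: its coefficients in `A` are killed by every real point. -/
lemma mem_span_tmul_of_forall_sliceRight_eq_zero {V : Type*} [AddCommGroup V] [Module ℝ V]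
    (u : V ⊗[ℝ] A) (hu : ∀ h : RealPoints A, sliceRight h.ofConv.toLinearMap u = 0) :
    u ∈ Submodule.span ℝ {t | ∃ v : V, ∃ a ∈ vanishingIdeal A, v ⊗ₜ[ℝ] a = t} := by
  let b := Module.Basis.ofVectorSpace ℝ V
  classical
  obtain ⟨c, rfl⟩ := (TensorProduct.equivFinsuppOfBasisLeft (N := A) b).symm.surjective u
  simp only [TensorProduct.equivFinsuppOfBasisLeft_symm_apply] at hu ⊢
  refine Submodule.sum_mem _ fun i _ => Submodule.subset_span ⟨b i, c i, ?_, rfl⟩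
  refine mem_vanishingIdeal.2 fun h => ?_
  have h₁ := hu h
  simp only [Finsupp.sum, map_sum, sliceRight_tmul] at h₁
  by_cases hi : i ∈ c.support
  · exact linearIndependent_iff'.1 b.linearIndependent _ _ h₁ i hi
  · simp [Finsupp.notMem_support_iff.1 hi]

/-- By Krull, each `a` in all powers of `m` satisfies `r a = a` for some `r ∈ m`. So `I = m I`, and
Nakayama gives one `f` for the whole of `I`. -/
lemma exists_mem_augmentationIdeal_mul_eq [IsNoetherianRing A] :
    ∃ f ∈ augmentationIdeal A, ∀ a ∈ vanishingIdeal A, f * a = a := by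
  have hle : vanishingIdeal A ≤ augmentationIdeal A • vanishingIdeal A := fun a ha => by
    obtain ⟨r, hr⟩ := ((augmentationIdeal A).mem_iInf_smul_pow_eq_bot_iff a).1
      (by simpa [Submodule.mem_iInf] using fun n => vanishingIdeal_le_pow n ha)
    rw [← hr]
    exact Ideal.mul_mem_mul r.2 ha
  obtain ⟨f, hf, h⟩ := Submodule.exists_mem_and_smul_eq_self_of_fg_of_le_smul _ _
    (IsNoetherian.noetherian (vanishingIdeal A)) hle
  exact ⟨f, hf, h⟩

/-- For `y ∈ I`, all real translates of `f` fix `y`, so `u = ∑ f₁ y ⊗ f₂ - y ⊗ 1` has zero slices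
and comes from `I ⊗ I`. Applying the antipode to the second factor and multiplying sends `u` to
`ε(f) y - y = -y`, and lands in `I²` because the antipode preserves `I`. -/
lemma isIdempotentElem_vanishingIdeal [IsNoetherianRing A] :
    IsIdempotentElem (vanishingIdeal A) := by
  obtain ⟨f, hf, hfI⟩ := exists_mem_augmentationIdeal_mul_eq (A := A)
  refine le_antisymm Ideal.mul_le_left fun y hy => ?_
  have htrans (h : RealPoints A) : translateBy h.ofConv.toLinearMap f * y = y := by
    -- Use `f` on the translate of `y` by `h⁻¹`, still in `I`, then translate back by `h`.
    have := congrArg (translateBy h.ofConv.toLinearMap)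
      (hfI _ (translateBy_mem_vanishingIdeal h⁻¹ hy))
    rwa [translateBy_algHom_mul, translateBy_translateBy_inv] at this
  let I := (vanishingIdeal A).restrictScalars ℝ
  let μ : A →ₗ[ℝ] I :=
    { toFun a := ⟨a * y, (vanishingIdeal A).mul_mem_left a hy⟩
      map_add' a b := Subtype.ext (add_mul a b y)
      map_smul' c a := Subtype.ext (smul_mul_assoc c a y) }
  let u : I ⊗[ℝ] A := μ.rTensor A (comul f) - (⟨y, hy⟩ : I) ⊗ₜ[ℝ] 1
  have hslice (h : A →ₐ[ℝ] ℝ) (t : A ⊗[ℝ] A) :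
      I.subtype (sliceRight h.toLinearMap (μ.rTensor A t)) = sliceRight h.toLinearMap t * y := by
    induction t with
    | zero => simp
    | add s t hs ht => simp only [map_add, add_mul, hs, ht]
    | tmul a b => simp [μ]
  have hu := mem_span_tmul_of_forall_sliceRight_eq_zero u fun h => by
    refine Subtype.ext ?_
    have := htrans h
    rw [translateBy, LinearMap.comp_apply, ← hslice] at this
    simpa [u, sub_eq_zero] using this
  let Ψ : I ⊗[ℝ] A →ₗ[ℝ] A :=
    LinearMap.mul' ℝ A ∘ₗ TensorProduct.map I.subtype (HopfAlgebra.antipode ℝ)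
  have hΨ (t : A ⊗[ℝ] A) : Ψ (μ.rTensor A t) =
      LinearMap.mul' ℝ A ((HopfAlgebra.antipode ℝ).lTensor A t) * y := by
    induction t with
    | zero => simp
    | add s t hs ht => simp only [map_add, add_mul, hs, ht]
    | tmul a b => simp [Ψ, μ]; ring
  have hΨu : Ψ u = -y := by
    rw [map_sub, hΨ, HopfAlgebra.mul_antipode_lTensor_comul_apply, mem_augmentationIdeal.1 hf]
    simp [Ψ]
  have hmem (t) (ht : t ∈ Submodule.span ℝ
      {t : I ⊗[ℝ] A | ∃ v : I, ∃ a ∈ vanishingIdeal A, v ⊗ₜ[ℝ] a = t}) :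
      Ψ t ∈ vanishingIdeal A * vanishingIdeal A := by
    induction ht using Submodule.span_induction with
    | mem t ht =>
      obtain ⟨v, a, ha, rfl⟩ := ht
      exact Ideal.mul_mem_mul v.2 (antipode_mem_vanishingIdeal ha)
    | zero => simp
    | add s t _ _ hs ht => rw [map_add]; exact add_mem hs ht
    | smul c t _ ht =>
      rw [map_smul, Algebra.smul_def]
      exact Ideal.mul_mem_left _ _ ht
  have := hmem u hu
  rw [hΨu] at this
  simpa using this

/-- If `Spec A` has no imaginary components, then the rational points are dense in a strong sense:
a regular function vanishing at all of them is zero. -/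
lemma vanishingIdeal_eq_bot [Algebra.FiniteType ℝ A] (hA : NoImaginaryComponents A) :
    vanishingIdeal A = ⊥ := by
  have : IsNoetherianRing A := Algebra.FiniteType.isNoetherianRing ℝ A
  obtain ⟨e, he, hI⟩ := ((vanishingIdeal A).isIdempotentElem_iff_of_fg
    (IsNoetherian.noetherian _)).1 isIdempotentElem_vanishingIdeal
  have heI : e ∈ vanishingIdeal A := hI ▸ Ideal.subset_span rfl
  have hclopen : IsClopen (PrimeSpectrum.basicOpen e : Set (PrimeSpectrum A)) :=
    PrimeSpectrum.isClopen_iff.2 ⟨e, he, rfl⟩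
  -- A prime where `e ≠ 0` would share its component, and so the clopen set `D(e)`, with a real
  -- point; but `e` vanishes at real points.
  have hnil : IsNilpotent e := by
    rw [nilpotent_iff_mem_prime]
    intro J hJ
    obtain ⟨g, hg⟩ := hA ⟨J, hJ⟩
    by_contra h
    have := hclopen.connectedComponent_subset (x := ⟨J, hJ⟩) h hg
    exact this (mem_vanishingIdeal.1 heI g)
  have he0 : e = 0 := by
    obtain ⟨n, hn⟩ := hnil
    rcases n with _ | n
    · rw [← mul_one e, ← pow_zero e, hn, mul_zero]
    · rwa [he.pow_succ_eq] at hn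
  rw [hI, he0]
  simp

end Density

/-! ### Restriction to the rational points is an equivalence -/

section Equivalence

open Coalgebra

variable {A : Type*} [CommRing A] [HopfAlgebra ℝ A]

lemma eq_of_forall_realPoints (hA : vanishingIdeal A = ⊥) {a b : A}
    (h : ∀ g : RealPoints A, g.ofConv a = g.ofConv b) : a = b := by
  rw [← sub_eq_zero, ← Ideal.mem_bot, ← hA, mem_vanishingIdeal]
  simp [h]

/-- Density for `G × G`, obtained one factor at a time. -/
lemma eq_of_forall_realPoints_prod (hA : vanishingIdeal A = ⊥) {u v : A ⊗[ℝ] A}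
    (huv : ∀ g h : RealPoints A, g.ofConv (sliceRight h.ofConv.toLinearMap u) =
      g.ofConv (sliceRight h.ofConv.toLinearMap v)) : u = v := by
  rw [← sub_eq_zero]
  have := mem_span_tmul_of_forall_sliceRight_eq_zero (u - v) fun h => by
    rw [map_sub, sub_eq_zero]
    exact eq_of_forall_realPoints hA fun g => huv g h
  have hle : Submodule.span ℝ {t : A ⊗[ℝ] A | ∃ v : A, ∃ a ∈ vanishingIdeal A, v ⊗ₜ[ℝ] a = t} ≤
      ⊥ := by
    rw [Submodule.span_le]
    rintro _ ⟨v, a, ha, rfl⟩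
    rw [hA, Ideal.mem_bot] at ha
    simp [ha]
  exact hle this

/-- The morphism of Hopf algebras `ℝ[x_ij]_det → A` given by a multiplicative matrix. -/
def GLCoord.liftBialgHom {n : ℕ} (M : Matrix (Fin n) (Fin n) A) (hM : IsUnit M.det)
    (hcomul : ∀ i j, comul (R := ℝ) (M i j) = ∑ k, M i k ⊗ₜ[ℝ] M k j)
    (hcounit : ∀ i j, counit (R := ℝ) (M i j) = (1 : Matrix (Fin n) (Fin n) ℝ) i j) :
    GLCoord n →ₐc[ℝ] A :=
  have hX (i j : Fin n) : GLCoord.lift M hM (GLCoord.X n i j) = M i j :=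
    congrFun (congrFun (GLCoord.map_X_lift M hM) i) j
  BialgHom.ofAlgHom (GLCoord.lift M hM)
    (by
      apply GLCoord.algHom_ext
      ext i j
      simp [hX, hcounit, GLCoord.counit_X])
    (by
      apply GLCoord.algHom_ext
      ext i j
      simp [hX, hcomul, GLCoord.comul_X])

lemma GLCoord.liftBialgHom_X {n : ℕ} (M : Matrix (Fin n) (Fin n) A) (hM : IsUnit M.det)
    (hcomul : ∀ i j, comul (R := ℝ) (M i j) = ∑ k, M i k ⊗ₜ[ℝ] M k j)
    (hcounit : ∀ i j, counit (R := ℝ) (M i j) = (1 : Matrix (Fin n) (Fin n) ℝ) i j) :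
    (GLCoord.X n).map (GLCoord.liftBialgHom M hM hcomul hcounit) = M :=
  GLCoord.map_X_lift M hM

/-- An algebraic representation of the group of rational points comes from a representation of the
affine group, when the rational points are dense. -/
lemma exists_bialgHom_of_regular (hA : vanishingIdeal A = ⊥) {n : ℕ}
    (ρ : RealPoints A →* Matrix (Fin n) (Fin n) ℝ)
    (hρ : ∀ i j, RealPoints.IsRegular fun g => ρ g i j) :
    ∃ f : GLCoord n →ₐc[ℝ] A, ∀ g : RealPoints A, ((GLCoord.X n).map f).map g.ofConv = ρ g := by
  choose M hM using hρ
  let M : Matrix (Fin n) (Fin n) A := M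
  have hM (g : RealPoints A) : M.map g.ofConv = ρ g := by
    ext i j
    exact (hM i j g).symm
  have hM' (g : RealPoints A) (i j) : g.ofConv (M i j) = ρ g i j := by
    rw [← hM, Matrix.map_apply]
  have hunit : IsUnit M.det := by
    -- The antipode applied entrywise gives the inverse, since at `g` it evaluates to `ρ g⁻¹`.
    refine (Matrix.isUnit_iff_isUnit_det _).1 (IsUnit.of_mul_eq_one
      (M.map (HopfAlgebra.antipode ℝ)) ?_)
    ext i j
    refine eq_of_forall_realPoints hA fun g => ?_
    have h : ρ g * ρ g⁻¹ = 1 := by rw [← map_mul, mul_inv_cancel, map_one]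
    have h := congrFun (congrFun h i) j
    rw [Matrix.mul_apply] at h
    rw [Matrix.mul_apply, map_sum]
    simp only [map_mul, Matrix.map_apply, ← RealPoints.inv_ofConv_apply, hM', h]
    simp [Matrix.one_apply, apply_ite]
  refine ⟨GLCoord.liftBialgHom M hunit (fun i j => ?_) (fun i j => ?_), fun g => ?_⟩
  · refine eq_of_forall_realPoints_prod hA fun g h => ?_
    have : sliceRight h.ofConv.toLinearMap (comul (R := ℝ) (M i j)) =
        translateBy h.ofConv.toLinearMap (M i j) := rfl
    rw [this, g.apply_translateBy, hM', map_mul, Matrix.mul_apply]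
    simp [hM', mul_comm]
  · rw [← RealPoints.one_ofConv_apply, hM', map_one]
  · rw [GLCoord.liftBialgHom_X, hM]

namespace AffineRep

instance : (restriction A).Faithful where
  map_injective {V W f g} h := by
    have : f.toLinearMap = g.toLinearMap := congrArg (fun φ => φ.hom.hom.hom.hom) h
    exact Hom.ext this

lemma restriction_full (hA : vanishingIdeal A = ⊥) : (restriction A).Full where
  map_surjective {V W} φ := by
    let f : V.E →ₗ[ℝ] W.E := φ.hom.hom.hom.hom
    have hf (g : RealPoints A) : f ∘ₗ V.realRep g = W.realRep g ∘ₗ f :=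
      congrArg (fun ψ => ψ.hom.hom) (φ.hom.comm g)
    refine ⟨⟨f, ?_⟩, rfl⟩
    ext i j
    refine eq_of_forall_realPoints hA fun g => ?_
    have hmap : (homMatrix V W f).map g.ofConv =
        LinearMap.toMatrix (Module.finBasis ℝ V.E) (Module.finBasis ℝ W.E) f := by
      ext i j
      simp [homMatrix]
    have h := congrArg (LinearMap.toMatrix (Module.finBasis ℝ V.E) (Module.finBasis ℝ W.E)) (hf g)
    rw [LinearMap.toMatrix_comp _ (Module.finBasis ℝ V.E),
      LinearMap.toMatrix_comp _ (Module.finBasis ℝ W.E)] at h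
    simp only [realRep, MonoidHom.coe_mk, OneHom.coe_mk, LinearMap.toMatrix_toLin, ← hmap,
      ← Matrix.map_mul] at h
    exact congrFun (congrFun h i) j

lemma restriction_essSurj (hA : vanishingIdeal A = ⊥) : (restriction A).EssSurj where
  mem_essImage E := by
    let b := Module.finBasis ℝ E.obj
    let ρ : RealPoints A →* Matrix (Fin (Module.finrank ℝ E.obj)) (Fin (Module.finrank ℝ E.obj)) ℝ :=
      (LinearMap.toMatrixAlgEquiv b : _ →* _).comp E.obj.ρ
    obtain ⟨f, hf⟩ := exists_bialgHom_of_regular hA ρ fun i j => by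
      simpa [ρ, LinearMap.toMatrixAlgEquiv_apply] using E.property.2 (b j) (b.coord i)
    -- The space is unchanged, so `realRep` uses the same basis `b` and the identity is the required
    -- isomorphism.
    let V : AffineRep A := { E := E.obj, ρ := f }
    have hV (g : RealPoints A) : V.realRep g = E.obj.ρ g := by
      change Matrix.toLin b b (((GLCoord.X _).map f).map g.ofConv) = _
      rw [hf]
      exact Matrix.toLin_toMatrix b b _
    refine ⟨V, ⟨ObjectProperty.isoMk _ (Action.mkIso (Iso.refl E.obj.V) fun g => ?_)⟩⟩
    ext v
    exact LinearMap.congr_fun (hV g) v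

/-- Restriction to the rational points is an equivalence when these are dense. -/
lemma restriction_isEquivalence (hA : vanishingIdeal A = ⊥) : (restriction A).IsEquivalence where
  full := restriction_full hA
  essSurj := restriction_essSurj hA

end AffineRep

end Equivalence

/-! ### The multiplicative group -/

section MultiplicativeGroup

open Coalgebra LaurentPolynomial

/-- A morphism `f` is regular if it has a generalized inverse `g`, with `f ≫ g ≫ f = f`. -/
def HasGeneralizedInverse {C : Type*} [Category C] {X Y : C} (f : X ⟶ Y) : Prop :=
  ∃ g : Y ⟶ X, f ≫ g ≫ f = f

lemma HasGeneralizedInverse.of_map {C D : Type*} [Category C] [Category D] (F : C ⥤ D) [F.Full]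
    [F.Faithful] {X Y : C} {f : X ⟶ Y} (h : HasGeneralizedInverse (F.map f)) :
    HasGeneralizedInverse f := by
  obtain ⟨g, hg⟩ := h
  obtain ⟨g, rfl⟩ := F.map_surjective g
  exact ⟨g, F.map_injective (by simpa using hg)⟩

lemma LinearMap.exists_generalizedInverse {K V W : Type*} [Field K] [AddCommGroup V] [Module K V]
    [AddCommGroup W] [Module K W] (f : V →ₗ[K] W) :
    ∃ g : W →ₗ[K] V, f ∘ₗ g ∘ₗ f = f := by
  obtain ⟨s, hs⟩ := f.rangeRestrict.exists_rightInverse_of_surjective f.range_rangeRestrict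
  obtain ⟨g, hg⟩ := s.exists_extend
  refine ⟨g, LinearMap.ext fun x => ?_⟩
  have h₁ : g (f x) = s (f.rangeRestrict x) := LinearMap.congr_fun hg (f.rangeRestrict x)
  have h₂ := LinearMap.congr_fun hs (f.rangeRestrict x)
  simpa [h₁] using congrArg Subtype.val h₂

/-- The coefficient of `T ^ n` as a linear functional. -/
def laurentCoeff (n : ℤ) : ℝ[T;T⁻¹] →ₗ[ℝ] ℝ where
  toFun x := x.coeff n
  map_add' _ _ := rfl
  map_smul' _ _ := rfl

lemma laurentCoeff_T (n k : ℤ) : laurentCoeff n (T k) = if k = n then 1 else 0 :=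
  T_apply n k

/-- Each `T k` is group-like, so the coefficient functionals are orthogonal idempotents for
convolution. They induce the weight projectors. -/
lemma laurentCoeff_comul (n m : ℤ) (x : ℝ[T;T⁻¹]) :
    LinearMap.mul' ℝ ℝ (TensorProduct.map (laurentCoeff n) (laurentCoeff m) (comul (R := ℝ) x)) =
      if n = m then laurentCoeff n x else 0 := by
  induction x using LaurentPolynomial.induction_on' with
  | add p q hp hq => simp only [map_add, hp, hq]; split_ifs <;> simp
  | C_mul_T k a =>
    rw [← LaurentPolynomial.smul_eq_C_mul, map_smul, LaurentPolynomial.comul_T]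
    simp only [map_smul, TensorProduct.map_tmul, LinearMap.mul'_apply, laurentCoeff_T]
    split_ifs <;> simp_all

lemma sum_laurentCoeff (x : ℝ[T;T⁻¹]) (s : Finset ℤ) (hs : ∀ n ∉ s, laurentCoeff n x = 0) :
    ∑ n ∈ s, laurentCoeff n x = counit (R := ℝ) x := by
  have h : counit (R := ℝ) x = x.coeff.sum fun _ a => a := by
    clear hs
    induction x using LaurentPolynomial.induction_on' with
    | add p q hp hq =>
      rw [map_add, hp, hq, AddMonoidAlgebra.coeff_add, Finsupp.sum_add_index'] <;> intros <;> rfl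
    | C_mul_T k a =>
      rw [LaurentPolynomial.counit_C_mul_T, ← single_eq_C_mul_T, AddMonoidAlgebra.coeff_single,
        Finsupp.sum_single_index rfl]
      rfl
  rw [h]
  refine (Finsupp.sum_of_support_subset x.coeff (s := s) (fun n hn => ?_) (fun _ a => a)
    fun _ _ => rfl).symm
  by_contra hns
  exact Finsupp.mem_support_iff.1 hn (hs n hns)

/-! ### Weight decomposition of representations of `GL_1` -/

namespace AffineRep

/-- The projector onto the subspace of weight `n` of a representation of `GL_1`. -/
def weightProj (V : AffineRep ℝ[T;T⁻¹]) (n : ℤ) :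
    Matrix (Fin (Module.finrank ℝ V.E)) (Fin (Module.finrank ℝ V.E)) ℝ :=
  V.matrix.map (laurentCoeff n)

lemma weightProj_mul (V : AffineRep ℝ[T;T⁻¹]) (n m : ℤ) :
    V.weightProj n * V.weightProj m = if n = m then V.weightProj n else 0 := by
  ext i j
  have h := laurentCoeff_comul n m (V.matrix i j)
  rw [comul_matrix] at h
  simp only [map_sum, TensorProduct.map_tmul, LinearMap.mul'_apply] at h
  rw [Matrix.mul_apply]
  refine h.trans ?_
  split_ifs <;> rfl

lemma exists_sum_weightProj (V : AffineRep ℝ[T;T⁻¹]) :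
    ∃ s : Finset ℤ, ∑ n ∈ s, V.weightProj n = 1 := by
  let s : Finset ℤ := Finset.univ.biUnion fun i => Finset.univ.biUnion fun j =>
    (V.matrix i j).coeff.support
  have hs (n) (hn : n ∉ s) (i j) : laurentCoeff n (V.matrix i j) = 0 := by
    simp only [s, Finset.mem_biUnion, Finset.mem_univ, true_and, not_exists,
      Finsupp.mem_support_iff, not_not] at hn
    exact hn i j
  refine ⟨s, Matrix.ext fun i j => ?_⟩
  rw [Matrix.sum_apply, ← counit_matrix,
    ← sum_laurentCoeff (V.matrix i j) s fun n hn => hs n hn i j]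
  rfl

/-- Compare coefficients of each power of `T`: equivariance means preserving weights. -/
lemma homMatrix_comm_iff {V W : AffineRep ℝ[T;T⁻¹]} (f : V.E →ₗ[ℝ] W.E) :
    homMatrix V W f * V.matrix = W.matrix * homMatrix V W f ↔
      ∀ n, LinearMap.toMatrix (Module.finBasis ℝ V.E) (Module.finBasis ℝ W.E) f * V.weightProj n =
        W.weightProj n * LinearMap.toMatrix (Module.finBasis ℝ V.E) (Module.finBasis ℝ W.E) f := by
  have h (n : ℤ) (c : ℝ) (x : ℝ[T;T⁻¹]) :
      laurentCoeff n (algebraMap ℝ _ c * x) = c * laurentCoeff n x := by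
    rw [← Algebra.smul_def, map_smul, smul_eq_mul]
  have h' (n : ℤ) (c : ℝ) (x : ℝ[T;T⁻¹]) :
      laurentCoeff n (x * algebraMap ℝ _ c) = laurentCoeff n x * c := by
    rw [mul_comm, h, mul_comm]
  have h₁ (n : ℤ) : (homMatrix V W f * V.matrix).map (laurentCoeff n) =
      LinearMap.toMatrix (Module.finBasis ℝ V.E) (Module.finBasis ℝ W.E) f * V.weightProj n := by
    ext i j
    simp only [homMatrix, weightProj, Matrix.map_apply, Matrix.mul_apply, map_sum, h]
  have h₂ (n : ℤ) : (W.matrix * homMatrix V W f).map (laurentCoeff n) =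
      W.weightProj n * LinearMap.toMatrix (Module.finBasis ℝ V.E) (Module.finBasis ℝ W.E) f := by
    ext i j
    simp only [homMatrix, weightProj, Matrix.map_apply, Matrix.mul_apply, map_sum, h']
  refine ⟨fun hf n => by rw [← h₁, ← h₂, hf], fun hf => Matrix.ext fun i j =>
    LaurentPolynomial.ext fun n => ?_⟩
  have := hf n
  rw [← h₁, ← h₂] at this
  exact congrFun (congrFun this i) j

/-- Linear representations of `GL_1` are semisimple, hence their morphisms are regular. -/
lemma hasGeneralizedInverse {V W : AffineRep ℝ[T;T⁻¹]} (f : V ⟶ W) : HasGeneralizedInverse f := by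
  let bV := Module.finBasis ℝ V.E
  let bW := Module.finBasis ℝ W.E
  obtain ⟨g, hg⟩ := f.toLinearMap.exists_generalizedInverse
  obtain ⟨s, hs₁⟩ := V.exists_sum_weightProj
  let F := LinearMap.toMatrix bV bW f.toLinearMap
  let S := LinearMap.toMatrix bW bV g
  have hF (n : ℤ) : F * V.weightProj n = W.weightProj n * F := (homMatrix_comm_iff _).1 f.comm n
  have hFSF : F * S * F = F := by
    have := congrArg (LinearMap.toMatrix bV bW) hg
    rwa [LinearMap.toMatrix_comp _ bV, LinearMap.toMatrix_comp _ bW, ← Matrix.mul_assoc] at this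
  -- The weight-preserving part of the linear generalized inverse `S`; it is equivariant and remains
  -- a generalized inverse.
  let S' := ∑ n ∈ s, V.weightProj n * S * W.weightProj n
  have hS' : LinearMap.toMatrix bW bV (Matrix.toLin bW bV S') = S' := LinearMap.toMatrix_toLin _ _ _
  have hS'F : F * S' * F = F := by
    calc F * S' * F = ∑ n ∈ s, F * (V.weightProj n * V.weightProj n) := by
          rw [Matrix.mul_sum, Matrix.sum_mul]
          refine Finset.sum_congr rfl fun n _ => ?_
          calc F * (V.weightProj n * S * W.weightProj n) * F
              = (F * V.weightProj n) * S * (W.weightProj n * F) := by simp only [Matrix.mul_assoc]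
            _ = (W.weightProj n * F) * S * (F * V.weightProj n) := by rw [hF]
            _ = W.weightProj n * (F * S * F) * V.weightProj n := by simp only [Matrix.mul_assoc]
            _ = _ := by rw [hFSF, ← hF, Matrix.mul_assoc]
      _ = F := by
        simp only [weightProj_mul, if_true]
        rw [← Matrix.mul_sum, hs₁, Matrix.mul_one]
  refine ⟨⟨Matrix.toLin bW bV S', (homMatrix_comm_iff _).2 fun m => ?_⟩, Hom.ext ?_⟩
  · change LinearMap.toMatrix bW bV (Matrix.toLin bW bV S') * _ =
      _ * LinearMap.toMatrix bW bV (Matrix.toLin bW bV S')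
    rw [hS', Matrix.sum_mul, Matrix.mul_sum]
    refine Finset.sum_congr rfl fun n _ => ?_
    rw [Matrix.mul_assoc, weightProj_mul, ← Matrix.mul_assoc, ← Matrix.mul_assoc, weightProj_mul]
    by_cases hnm : n = m
    · simp [hnm]
    · simp [hnm, Ne.symm hnm]
  · change (f.toLinearMap ∘ₗ Matrix.toLin bW bV S') ∘ₗ f.toLinearMap = f.toLinearMap
    apply (LinearMap.toMatrix bV bW).injective
    rw [LinearMap.toMatrix_comp _ bW, LinearMap.toMatrix_comp _ bV, hS']
    exact hS'F

end AffineRep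

/-! ### The logarithmic representation of `ℝˣ` -/

lemma noImaginaryComponents_laurent : NoImaginaryComponents ℝ[T;T⁻¹] := fun p =>
  ⟨1, by rw [PreconnectedSpace.connectedComponent_eq_univ]; trivial⟩

/-- The nilpotent operator `(x, y) ↦ (y, 0)` of the plane. -/
def shearNilpotent : ℝ × ℝ →ₗ[ℝ] ℝ × ℝ := LinearMap.inl ℝ ℝ ℝ ∘ₗ LinearMap.snd ℝ ℝ ℝ

lemma shearNilpotent_comp_self : shearNilpotent ∘ₗ shearNilpotent = 0 := by
  ext <;> simp [shearNilpotent]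

lemma RealPoints.apply_T_ne_zero (g : RealPoints ℝ[T;T⁻¹]) : g.ofConv (T 1) ≠ 0 :=
  ((isUnit_T 1).map g.ofConv).ne_zero

/-- The rational point of `GL_1` with coordinate `r`. -/
def RealPoints.ofUnit (r : ℝˣ) : RealPoints ℝ[T;T⁻¹] :=
  WithConv.toConv
    { LaurentPolynomial.eval₂ (RingHom.id ℝ) r with
      commutes' := fun c => LaurentPolynomial.eval₂_C (RingHom.id ℝ) r c }

lemma RealPoints.ofUnit_T (r : ℝˣ) : (RealPoints.ofUnit r).ofConv (T 1) = r := by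
  have := LaurentPolynomial.eval₂_T (RingHom.id ℝ) r 1
  exact this.trans (by simp)

/-- The representation of `ℝˣ` on the plane by `t ↦ [1, log |t|; 0, 1]`. -/
def logShear : Representation ℝ (RealPoints ℝ[T;T⁻¹]) (ℝ × ℝ) where
  -- `Real.log x` is `log |x|`, so negative points are covered as well.
  toFun g := LinearMap.id + Real.log (g.ofConv (T 1)) • shearNilpotent
  map_one' := by simp; rfl
  map_mul' g h := by
    have : (g * h).ofConv (T 1) = g.ofConv (T 1) * h.ofConv (T 1) := by
      rw [RealPoints.mul_apply, LaurentPolynomial.comul_T]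
      simp
    rw [this, Real.log_mul g.apply_T_ne_zero h.apply_T_ne_zero]
    ext <;> simp [shearNilpotent, add_comm]

lemma shearNilpotent_logShear (g : RealPoints ℝ[T;T⁻¹]) (v : ℝ × ℝ) :
    shearNilpotent (logShear g v) = logShear g (shearNilpotent v) := by
  change shearNilpotent (v + Real.log (g.ofConv (T 1)) • shearNilpotent v) =
    shearNilpotent v + Real.log (g.ofConv (T 1)) • shearNilpotent (shearNilpotent v)
  rw [map_add, map_smul]

lemma logShear_isLieRep : isLieRep ℝ[T;T⁻¹] (FDRep.of logShear) := by
  intro v φ g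
  refine ⟨1, fun _ => T 1, {x | x 0 ≠ 0}, fun x => φ v + Real.log (x 0) * φ (shearNilpotent v),
    isOpen_ne_fun (continuous_apply 0) continuous_const, g.apply_T_ne_zero, ?_, fun h _ => ?_⟩
  · exact contDiffOn_const.add (((contDiff_apply ℝ ℝ (0 : Fin 1)).contDiffOn.log fun x hx => hx).mul
      contDiffOn_const)
  · change φ (v + Real.log (h.ofConv (T 1)) • shearNilpotent v) = _
    rw [map_add, map_smul]
    rfl

/-- The representation `t ↦ [1, log |t|; 0, 1]` of the Lie group `ℝˣ`. -/
def logShearRep : LieRep ℝ[T;T⁻¹] := ⟨FDRep.of logShear, logShear_isLieRep⟩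

/-- The nilpotent endomorphism of the representation `t ↦ [1, log |t|; 0, 1]`. -/
def logShearEnd : logShearRep ⟶ logShearRep :=
  ObjectProperty.homMk
    { hom := FGModuleCat.ofHom shearNilpotent
      comm := fun g => by
        ext v
        exact shearNilpotent_logShear g v }

/-- Write `N` for the nilpotent. An equivariant `G` commutes with `N`, so `N G N = G N² = 0`,
whereas `N ≠ 0`. -/
lemma not_hasGeneralizedInverse_logShearEnd : ¬ HasGeneralizedInverse logShearEnd := by
  rintro ⟨g, hg⟩
  let G : ℝ × ℝ →ₗ[ℝ] ℝ × ℝ := g.hom.hom.hom.hom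
  have hG : (shearNilpotent ∘ₗ G) ∘ₗ shearNilpotent = shearNilpotent :=
    congrArg (fun ψ => ψ.hom.hom.hom.hom) hg
  -- The point `t = e` has logarithm `1`, so it acts by `1 + N`.
  have hcomm : G ∘ₗ logShear _ = logShear _ ∘ₗ G := congrArg (fun ψ => ψ.hom.hom)
    (g.hom.comm (RealPoints.ofUnit (Units.mk0 (Real.exp 1) (Real.exp_ne_zero 1))))
  have hlog : logShear (RealPoints.ofUnit (Units.mk0 (Real.exp 1) (Real.exp_ne_zero 1))) =
      LinearMap.id + shearNilpotent := by
    change LinearMap.id + Real.log ((RealPoints.ofUnit _).ofConv (T 1)) • shearNilpotent = _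
    simp [RealPoints.ofUnit_T]
  rw [hlog, LinearMap.comp_add, LinearMap.add_comp, LinearMap.comp_id, LinearMap.id_comp,
    add_right_inj] at hcomm
  rw [← hcomm, LinearMap.comp_assoc, shearNilpotent_comp_self, LinearMap.comp_zero] at hG
  have := congrArg Prod.fst (LinearMap.congr_fun hG (0, 1))
  simp [shearNilpotent] at this

end MultiplicativeGroup

end

theorem mainTheorem3 :
    (∀ (A : Type*) [CommRing A] [HopfAlgebra ℝ A], Algebra.FiniteType ℝ A →
      NoImaginaryComponents A → (AffineRep.restriction A).IsEquivalence) ∧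
    (NoImaginaryComponents ℝ[T;T⁻¹] ∧
      IsEmpty (AffineRep ℝ[T;T⁻¹] ≌ LieRep ℝ[T;T⁻¹])) := by
  refine ⟨fun A _ _ _ hA => AffineRep.restriction_isEquivalence (vanishingIdeal_eq_bot hA),
    noImaginaryComponents_laurent, ⟨fun e => ?_⟩⟩
  exact not_hasGeneralizedInverse_logShearEnd
    (.of_map e.inverse (AffineRep.hasGeneralizedInverse (e.inverse.map logShearEnd)))
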